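/- All vector spaces are real and all vector lattices are Archimedean. For vector lattices $E$ and $F$, let $\mathcal L_{\mathrm{ob}}(E,F)$ be the space of order bounded linear operators from $E$ to $F$, ordered by $S\le T$ if and only if $Sx\le Tx$ for all $x\ge 0$ in $E$; it is a (Dedekind complete) vector lattice when $F$ is Dedekind complete. A net $(x_\alpha)$ in $E$ is order convergent to $x$ if there is a net $y_\beta\downarrow 0$ in $E$ (with a possibly different index set) such that for every $\beta_0$ there is an $\alpha_0$ with $|x-x_\alpha|\le y_{\beta_0}$ for all $\alpha\ge\alpha_0$. A linear operator $T\colon E\to F$ is order continuous if it maps every net that is order convergent to $0$ to a net that is order convergent to $0$; such an operator is automatically order bounded. The order continuous operators are denoted by $\mathcal L_{\mathrm{oc}}(E,F)$, which is a vector sublattice of $\mathcal L_{\mathrm{ob}}(E,F)$ when $F$ is Dedekind complete. Write $\mathcal L_{\mathrm{ob}}(E)=\mathcal L_{\mathrm{ob}}(E,E)$ and $\mathcal L_{\mathrm{oc}}(E)=\mathcal L_{\mathrm{oc}}(E,E)$. A lattice homomorphism is a linear map that preserves binary suprema and infima. Proposition. Let $E$ be a Dedekind complete vector lattice. (1) For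 $T\in\mathcal L_{\mathrm{ob}}(E)$ and $S\in\mathcal L_{\mathrm{oc}}(E)$ put $\rho_T(S)=ST$. Then $\rho_T\in\mathcal L_{\mathrm{oc}}(\mathcal L_{\mathrm{oc}}(E),\mathcal L_{\mathrm{ob}}(E))$ for all $T\in\mathcal L_{\mathrm{ob}}(E)$, and $T\mapsto\rho_T$ is an order continuous lattice homomorphism from $\mathcal L_{\mathrm{ob}}(E)$ into $\mathcal L_{\mathrm{oc}}(\mathcal L_{\mathrm{oc}}(E),\mathcal L_{\mathrm{ob}}(E))$. (2) For $T,S\in\mathcal L_{\mathrm{ob}}(E)$ put $\lambda_T(S)=TS$. Then $\lambda_T\in\mathcal L_{\mathrm{ob}}(\mathcal L_{\mathrm{ob}}(E))$ for all $T\in\mathcal L_{\mathrm{ob}}(E)$, and $T\mapsto\lambda_T$ is an order continuous lattice homomorphism from $\mathcal L_{\mathrm{ob}}(E)$ into $\mathcal L_{\mathrm{ob}}(\mathcal L_{\mathrm{ob}}(E))$. Moreover, $\lambda_T\in\mathcal L_{\mathrm{oc}}(\mathcal L_{\mathrm{ob}}(E))$ for all $T\in\mathcal L_{\mathrm{oc}}(E)$.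 -/

import Mathlib

set_option linter.unusedSectionVars false

universe u v w

noncomputable section

namespace VLat

/-! Vector lattices are real vector spaces with a lattice order that is compatible with addition and
with multiplication by nonnegative reals; a vector lattice is Dedekind complete if its order is that
of a `ConditionallyCompleteLattice`. -/

section Cone

variable {E : Type u} [AddCommGroup E] [Lattice E] [IsOrderedAddMonoid E]

theorem decomp {x y z w : E} (hx : 0 ≤ x) (hy : 0 ≤ y) (hz : 0 ≤ z) (hw : 0 ≤ w)
    (h : x + y = z + w) :
    ∃ x₁ x₂ y₁ y₂ : E, 0 ≤ x₁ ∧ 0 ≤ x₂ ∧ 0 ≤ y₁ ∧ 0 ≤ y₂ ∧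
      x = x₁ + x₂ ∧ y = y₁ + y₂ ∧ z = x₁ + y₁ ∧ w = x₂ + y₂ := by
  have h1 : x - w = z - y := by
    rw [sub_eq_sub_iff_add_eq_add, h]
  have h2 : x - w ≤ x ⊓ z := by
    refine le_inf (sub_le_self x hw) ?_
    rw [h1]
    exact sub_le_self z hy
  have h3 : w = x + y - z := by rw [h]; abel
  refine ⟨x ⊓ z, x - x ⊓ z, z - x ⊓ z, x ⊓ z - (x - w), le_inf hx hz, sub_nonneg.2 inf_le_left,
    sub_nonneg.2 inf_le_right, sub_nonneg.2 h2, by abel, ?_, by abel, by abel⟩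
  rw [h3]; abel

variable [Module ℝ E] [IsOrderedModule ℝ E]
variable {F : Type v} [AddCommGroup F] [Module ℝ F]

theorem exists_linear_extension (p : E → F)
    (hadd : ∀ x y, 0 ≤ x → 0 ≤ y → p (x + y) = p x + p y)
    (hsmul : ∀ (c : ℝ) x, 0 ≤ c → 0 ≤ x → p (c • x) = c • p x) :
    ∃ T : E →ₗ[ℝ] F, ∀ x, 0 ≤ x → T x = p x := by
  have p0 : p 0 = 0 := by simpa using hsmul 0 0 le_rfl le_rfl
  have key : ∀ x a b : E, 0 ≤ a → 0 ≤ b → x = a - b → p (x⁺) - p (x⁻) = p a - p b := by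
    intro x a b ha hb hx
    have h1 : x⁺ + b = a + x⁻ := by
      have := posPart_sub_negPart x
      rw [← sub_eq_sub_iff_add_eq_add, this, hx]
    have h2 : p (x⁺) + p b = p a + p (x⁻) := by
      rw [← hadd _ _ (posPart_nonneg x) hb, h1, hadd _ _ ha (negPart_nonneg x)]
    rw [sub_eq_sub_iff_add_eq_add, h2]
  refine ⟨{ toFun := fun x => p (x⁺) - p (x⁻), map_add' := ?_, map_smul' := ?_ }, ?_⟩
  · intro x y
    rw [key (x + y) (x⁺ + y⁺) (x⁻ + y⁻) (add_nonneg (posPart_nonneg _) (posPart_nonneg _))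
      (add_nonneg (negPart_nonneg _) (negPart_nonneg _))]
    · rw [hadd _ _ (posPart_nonneg _) (posPart_nonneg _),
        hadd _ _ (negPart_nonneg _) (negPart_nonneg _)]
      abel
    · conv_lhs => rw [← posPart_sub_negPart x, ← posPart_sub_negPart y]
      abel
  · intro c x
    simp only [RingHom.id_apply]
    rcases le_total 0 c with hc | hc
    · rw [key (c • x) (c • x⁺) (c • x⁻) (smul_nonneg hc (posPart_nonneg _))
        (smul_nonneg hc (negPart_nonneg _)), hsmul _ _ hc (posPart_nonneg _),
        hsmul _ _ hc (negPart_nonneg _), smul_sub]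
      rw [← smul_sub, posPart_sub_negPart]
    · have hc' : 0 ≤ -c := by linarith
      rw [key (c • x) ((-c) • x⁻) ((-c) • x⁺) (smul_nonneg hc' (negPart_nonneg _))
        (smul_nonneg hc' (posPart_nonneg _)), hsmul _ _ hc' (posPart_nonneg _),
        hsmul _ _ hc' (negPart_nonneg _), smul_sub, neg_smul, neg_smul]
      · abel
      · conv_lhs => rw [← posPart_sub_negPart x]
        rw [smul_sub, neg_smul, neg_smul]
        abel
  · intro x hx
    change p (x⁺) - p (x⁻) = p x
    rw [key x x 0 hx le_rfl (by simp), p0, sub_zero]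

end Cone

section Convergence

variable {E : Type u} [AddCommGroup E] [Lattice E]

/-- Order convergence of the net `x` to `l`: there is a net `y` (over a possibly different index
set) that decreases to `0` and such that every `y b` eventually dominates `|l - x a|`. -/
def OrderConv {ι : Type w} [Preorder ι] (x : ι → E) (l : E) : Prop :=
  ∃ (κ : Type u) (_ : Preorder κ) (_ : IsDirectedOrder κ) (_ : Nonempty κ) (y : κ → E),
    Antitone y ∧ IsGLB (Set.range y) 0 ∧ ∀ b : κ, ∃ a₀ : ι, ∀ a : ι, a₀ ≤ a → |l - x a| ≤ y b

end Convergence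

section Operators

variable {E : Type u} [AddCommGroup E] [Lattice E] [Module ℝ E]
variable {F : Type v} [AddCommGroup F] [Lattice F] [Module ℝ F]

/-- A linear operator is order bounded if it maps order bounded sets to order bounded sets. -/
def IsOrderBounded (T : E →ₗ[ℝ] F) : Prop :=
  ∀ s : Set E, BddBelow s → BddAbove s → BddBelow (T '' s) ∧ BddAbove (T '' s)

/-- A linear operator is order continuous if it maps nets that are order convergent to `0` to nets
that are order convergent to `0`. -/
def IsOrderContinuous (T : E →ₗ[ℝ] F) : Prop :=
  ∀ (ι : Type u) [Preorder ι] [IsDirectedOrder ι] [Nonempty ι] (x : ι → E),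
    OrderConv x 0 → OrderConv (fun a => T (x a)) 0

/-- A linear operator is a lattice homomorphism if it preserves binary suprema and infima. -/
def IsLatticeHom (T : E →ₗ[ℝ] F) : Prop :=
  ∀ x y : E, T (x ⊔ y) = T x ⊔ T y ∧ T (x ⊓ y) = T x ⊓ T y

variable [IsOrderedAddMonoid E] [IsOrderedAddMonoid F]

theorem isOrderBounded_iff {T : E →ₗ[ℝ] F} :
    IsOrderBounded T ↔ ∀ x, 0 ≤ x → ∃ c, ∀ y, 0 ≤ y → y ≤ x → T y ≤ c := by
  constructor
  · intro h x _
    obtain ⟨c, hc⟩ := (h (Set.Icc 0 x) bddBelow_Icc bddAbove_Icc).2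
    exact ⟨c, fun y h0 h1 => hc ⟨y, ⟨h0, h1⟩, rfl⟩⟩
  · rintro h s ⟨a, ha⟩ ⟨b, hb⟩
    rcases s.eq_empty_or_nonempty with rfl | ⟨s₀, hs₀⟩
    · simp
    have hab : 0 ≤ b - a := sub_nonneg.2 ((ha hs₀).trans (hb hs₀))
    obtain ⟨c, hc⟩ := h (b - a) hab
    constructor
    · refine ⟨T b - c, ?_⟩
      rintro _ ⟨y, hy, rfl⟩
      have := hc (b - y) (sub_nonneg.2 (hb hy)) (sub_le_sub_left (ha hy) b)
      rw [map_sub] at this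
      exact sub_le_comm.1 this
    · refine ⟨c + T a, ?_⟩
      rintro _ ⟨y, hy, rfl⟩
      have := hc (y - a) (sub_nonneg.2 (ha hy)) (sub_le_sub_right (hb hy) a)
      rw [map_sub] at this
      exact sub_le_iff_le_add.1 this

theorem orderConv_zero_iff {ι : Type w} [Preorder ι] {x : ι → E} :
    OrderConv x 0 ↔ ∃ (κ : Type u) (_ : Preorder κ) (_ : IsDirectedOrder κ) (_ : Nonempty κ)
      (y : κ → E), Antitone y ∧ IsGLB (Set.range y) 0 ∧
        ∀ b : κ, ∃ a₀ : ι, ∀ a : ι, a₀ ≤ a → |x a| ≤ y b := by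
  simp only [OrderConv, zero_sub, abs_neg]

theorem OrderConv.add {ι : Type w} [Preorder ι] [IsDirectedOrder ι] {x y : ι → E}
    (hx : OrderConv x 0) (hy : OrderConv y 0) : OrderConv (fun a => x a + y a) 0 := by
  rw [orderConv_zero_iff] at *
  obtain ⟨κ, _, _, _, f, hf, hf0, hfx⟩ := hx
  obtain ⟨κ', _, _, _, g, hg, hg0, hgy⟩ := hy
  refine ⟨κ × κ', inferInstance, ⟨?_⟩, inferInstance, fun b => f b.1 + g b.2, ?_, ?_, ?_⟩
  · rintro ⟨a, b⟩ ⟨c, d⟩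
    obtain ⟨e, he1, he2⟩ := exists_ge_ge a c
    obtain ⟨k, hk1, hk2⟩ := exists_ge_ge b d
    exact ⟨(e, k), ⟨he1, hk1⟩, ⟨he2, hk2⟩⟩
  · rintro a b h
    exact add_le_add (hf h.1) (hg h.2)
  · constructor
    · rintro _ ⟨b, rfl⟩
      exact add_nonneg (hf0.1 ⟨b.1, rfl⟩) (hg0.1 ⟨b.2, rfl⟩)
    · intro l hl
      refine hf0.2 ?_
      rintro _ ⟨b, rfl⟩
      have : l - f b ≤ 0 := by
        refine hg0.2 ?_
        rintro _ ⟨b', rfl⟩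
        exact sub_le_iff_le_add'.2 (hl ⟨(b, b'), rfl⟩)
      exact sub_nonpos.1 this
  · rintro ⟨b, b'⟩
    obtain ⟨a, ha⟩ := hfx b
    obtain ⟨a', ha'⟩ := hgy b'
    obtain ⟨e, he1, he2⟩ := exists_ge_ge a a'
    refine ⟨e, fun k hk => (abs_add_le _ _).trans ?_⟩
    exact add_le_add (ha k (he1.trans hk)) (ha' k (he2.trans hk))

theorem OrderConv.smul [IsOrderedModule ℝ E] {ι : Type w} [Preorder ι] [Nonempty ι] {x : ι → E}
    (c : ℝ) (hx : OrderConv x 0) : OrderConv (fun a => c • x a) 0 := by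
  rw [orderConv_zero_iff] at *
  obtain ⟨κ, i1, i2, i3, f, hf, hf0, hfx⟩ := hx
  have habs : ∀ z : E, |c • z| ≤ |c| • |z| := by
    intro z
    rcases le_total 0 c with hc | hc
    · rw [abs_of_nonneg hc, abs_le']
      refine ⟨smul_le_smul_of_nonneg_left (le_abs_self z) hc, ?_⟩
      rw [← smul_neg]
      exact smul_le_smul_of_nonneg_left (neg_le_abs z) hc
    · have hc' : 0 ≤ -c := by linarith
      rw [abs_of_nonpos hc, abs_le']
      refine ⟨?_, ?_⟩
      · rw [← neg_smul_neg]
        exact smul_le_smul_of_nonneg_left (neg_le_abs z) hc'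
      · rw [← neg_smul]
        exact smul_le_smul_of_nonneg_left (le_abs_self z) hc'
  refine ⟨κ, i1, i2, i3, fun b => |c| • f b, ?_, ?_, ?_⟩
  · intro a b h
    exact smul_le_smul_of_nonneg_left (hf h) (abs_nonneg c)
  · constructor
    · rintro _ ⟨b, rfl⟩
      exact smul_nonneg (abs_nonneg c) (hf0.1 ⟨b, rfl⟩)
    · intro l hl
      rcases (abs_nonneg c).eq_or_lt with hc | hc
      · obtain ⟨b⟩ := i3
        have := hl ⟨b, rfl⟩
        simpa [← hc] using this
      · have : |c|⁻¹ • l ≤ 0 := by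
          refine hf0.2 ?_
          rintro _ ⟨b, rfl⟩
          have := smul_le_smul_of_nonneg_left (hl ⟨b, rfl⟩) (inv_nonneg.2 hc.le)
          simpa [smul_smul, inv_mul_cancel₀ hc.ne'] using this
        have := smul_le_smul_of_nonneg_left this hc.le
        simpa [smul_smul, mul_inv_cancel₀ hc.ne'] using this
  · intro b
    obtain ⟨a, ha⟩ := hfx b
    exact ⟨a, fun k hk => (habs _).trans (smul_le_smul_of_nonneg_left (ha k hk) (abs_nonneg c))⟩

theorem OrderConv.zero {ι : Type w} [Preorder ι] [Nonempty ι] :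
    OrderConv (fun _ : ι => (0 : E)) 0 := by
  rw [orderConv_zero_iff]
  obtain ⟨i⟩ := ‹Nonempty ι›
  refine ⟨PUnit, inferInstance, inferInstance, inferInstance, fun _ => 0, antitone_const, ?_, ?_⟩
  · simp
  · exact fun _ => ⟨i, fun _ _ => by simp⟩

/-- An order continuous operator on an Archimedean vector lattice is automatically order
bounded. -/
theorem IsOrderContinuous.isOrderBounded [IsOrderedModule ℝ E]
    (harch : ∀ x y : E, (∀ n : ℕ, n • x ≤ y) → x ≤ 0) {T : E →ₗ[ℝ] F} [IsOrderedModule ℝ F]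
    (hT : IsOrderContinuous T) : IsOrderBounded T := by
  rw [isOrderBounded_iff]
  intro x hx
  obtain ⟨ι, _, _, _, g, hg, hgle⟩ : ∃ (ι : Type u) (_ : Preorder ι) (_ : IsDirectedOrder ι)
      (_ : Nonempty ι) (g : ι → ℕ × Set.Icc (0 : E) x),
        Function.Surjective g ∧ ∀ a b, a ≤ b ↔ (g a).1 ≤ (g b).1 := by
    refine ⟨ℕ × Set.Icc (0 : E) x, Preorder.lift Prod.fst, @IsDirected.mk _ _ fun a b => ?_,
      ⟨(0, ⟨0, le_rfl, hx⟩)⟩, id, Function.surjective_id, fun _ _ => Iff.rfl⟩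
    rcases le_total a.1 b.1 with h | h
    · exact ⟨b, h, le_refl b.1⟩
    · exact ⟨a, le_refl a.1, h⟩
  have hpos : ∀ n : ℕ, 0 < ((n : ℝ) + 1) := fun n => by positivity
  have hconv : OrderConv (fun a : ι => (((g a).1 : ℝ) + 1)⁻¹ • ((g a).2 : E)) 0 := by
    rw [orderConv_zero_iff]
    refine ⟨ULift ℕ, inferInstance, ⟨fun a b => ?_⟩, inferInstance,
      fun n => ((n.down : ℝ) + 1)⁻¹ • x, ?_, ⟨?_, ?_⟩, ?_⟩
    · rcases le_total a b with h | h
      · exact ⟨b, h, le_refl b⟩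
      · exact ⟨a, le_refl a, h⟩
    · intro a b h
      refine smul_le_smul_of_nonneg_right ?_ hx
      have : (a.down : ℝ) ≤ b.down := by exact_mod_cast h
      exact inv_anti₀ (hpos _) (by linarith)
    · rintro _ ⟨n, rfl⟩
      exact smul_nonneg (inv_nonneg.2 (hpos _).le) hx
    · intro l hl
      refine harch l x fun n => ?_
      cases n with
      | zero => simpa using hx
      | succ n =>
        have h1 := smul_le_smul_of_nonneg_left (hl ⟨⟨n⟩, rfl⟩) (hpos n).le
        simp only [smul_smul, mul_inv_cancel₀ (hpos n).ne', one_smul] at h1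
        rw [← Nat.cast_smul_eq_nsmul ℝ]
        simpa using h1
    · intro n
      obtain ⟨a₀, ha₀⟩ := hg (n.down, ⟨0, le_rfl, hx⟩)
      refine ⟨a₀, fun a ha => ?_⟩
      have ha' : n.down ≤ (g a).1 := by simpa [hgle, ha₀] using ha
      rw [abs_of_nonneg (smul_nonneg (inv_nonneg.2 (hpos _).le) (g a).2.2.1)]
      refine (smul_le_smul_of_nonneg_left (g a).2.2.2 (inv_nonneg.2 (hpos _).le)).trans ?_
      refine smul_le_smul_of_nonneg_right ?_ hx
      have : (n.down : ℝ) ≤ (g a).1 := by exact_mod_cast ha'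
      exact inv_anti₀ (hpos _) (by linarith)
  have h2 := hT ι _ hconv
  rw [orderConv_zero_iff] at h2
  obtain ⟨κ', _, _, ⟨b⟩, f, -, -, hf⟩ := h2
  obtain ⟨a, ha⟩ := hf b
  refine ⟨(((g a).1 : ℝ) + 1) • f b, fun y h0 h1 => ?_⟩
  obtain ⟨a', ha'⟩ := hg ((g a).1, ⟨y, h0, h1⟩)
  have h3 := (le_abs_self _).trans (ha a' (by rw [hgle, ha']))
  rw [ha', map_smul] at h3
  have h4 := smul_le_smul_of_nonneg_left h3 (hpos (g a).1).le
  simpa only [smul_smul, mul_inv_cancel₀ (hpos (g a).1).ne', one_smul] using h4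

variable [IsOrderedModule ℝ E] [IsOrderedModule ℝ F]

variable (E F) in
/-- The vector space of order bounded operators from `E` to `F`. -/
def orderBounded : Submodule ℝ (E →ₗ[ℝ] F) where
  carrier := {T | IsOrderBounded T}
  zero_mem' := isOrderBounded_iff.2 fun _ _ => ⟨0, fun _ _ _ => by simp⟩
  add_mem' := by
    intro S T hS hT
    simp only [Set.mem_ofPred_eq, isOrderBounded_iff] at *
    intro x hx
    obtain ⟨c, hc⟩ := hS x hx
    obtain ⟨d, hd⟩ := hT x hx
    exact ⟨c + d, fun y h0 h1 => add_le_add (hc y h0 h1) (hd y h0 h1)⟩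
  smul_mem' := by
    intro c T hT
    simp only [Set.mem_ofPred_eq] at *
    rcases le_total 0 c with hc | hc
    · rw [isOrderBounded_iff] at *
      intro x hx
      obtain ⟨d, hd⟩ := hT x hx
      exact ⟨c • d, fun y h0 h1 => smul_le_smul_of_nonneg_left (hd y h0 h1) hc⟩
    · rw [isOrderBounded_iff]
      intro x hx
      obtain ⟨d, hd⟩ := (hT (Set.Icc 0 x) bddBelow_Icc bddAbove_Icc).1
      refine ⟨c • d, fun y h0 h1 => ?_⟩
      have := smul_le_smul_of_nonneg_left (hd ⟨y, ⟨h0, h1⟩, rfl⟩) (neg_nonneg.2 hc)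
      rw [neg_smul, neg_smul] at this
      exact neg_le_neg_iff.1 this

variable (E F) in
/-- The vector space of order continuous operators from `E` to `F`. If `E` is Archimedean, then the
order boundedness is automatic: see `mem_orderCont_iff`. -/
def orderCont : Submodule ℝ (E →ₗ[ℝ] F) where
  carrier := {T | IsOrderBounded T ∧ IsOrderContinuous T}
  zero_mem' := ⟨(orderBounded E F).zero_mem, fun _ _ _ _ _ _ => OrderConv.zero⟩
  add_mem' := fun hS hT => ⟨(orderBounded E F).add_mem hS.1 hT.1,
    fun ι _ _ _ x hx => (hS.2 ι x hx).add (hT.2 ι x hx)⟩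
  smul_mem' := fun c _ hT => ⟨(orderBounded E F).smul_mem c hT.1,
    fun ι _ _ _ x hx => (hT.2 ι x hx).smul c⟩

theorem mem_orderCont_iff (harch : ∀ x y : E, (∀ n : ℕ, n • x ≤ y) → x ≤ 0) {T : E →ₗ[ℝ] F} :
    T ∈ orderCont E F ↔ IsOrderContinuous T :=
  ⟨fun h => h.2, fun h => ⟨h.isOrderBounded harch, h⟩⟩

variable (E F) in
/-- `𝓛_ob(E, F)`. -/
abbrev Lob : Type (max u v) := orderBounded E F

variable (E F) in
/-- `𝓛_oc(E, F)`. -/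
abbrev Loc : Type (max u v) := orderCont E F

instance : AddCommGroup (Lob E F) := Submodule.addCommGroup _

instance : Module ℝ (Lob E F) := Submodule.module _

instance : AddCommGroup (Loc E F) := Submodule.addCommGroup _

instance : Module ℝ (Loc E F) := Submodule.module _

/-- The operator ordering: `S ≤ T` if `S x ≤ T x` for all `x ≥ 0`. -/
instance : PartialOrder (Lob E F) where
  le S T := ∀ x : E, 0 ≤ x → S.1 x ≤ T.1 x
  le_refl _ _ _ := le_rfl
  le_trans _ _ _ h h' x hx := (h x hx).trans (h' x hx)
  le_antisymm S T h h' := by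
    refine Subtype.ext (LinearMap.ext fun x => ?_)
    have key : ∀ y : E, 0 ≤ y → S.1 y = T.1 y := fun y hy => le_antisymm (h y hy) (h' y hy)
    rw [← posPart_sub_negPart x, map_sub, map_sub, key _ (posPart_nonneg x),
      key _ (negPart_nonneg x)]

theorem Lob.le_def {S T : Lob E F} : S ≤ T ↔ ∀ x : E, 0 ≤ x → S.1 x ≤ T.1 x := Iff.rfl

instance : IsOrderedAddMonoid (Lob E F) where
  add_le_add_left _ _ h c x hx := add_le_add_left (h x hx) (c.1 x)

instance : IsOrderedModule ℝ (Lob E F) where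
  smul_le_smul_of_nonneg_left _ hc _ _ h x hx := smul_le_smul_of_nonneg_left (h x hx) hc
  smul_le_smul_of_nonneg_right _ hT _ _ h x hx := smul_le_smul_of_nonneg_right h (hT x hx)

/-- `Reach A x v`: one can write `x = x₁ + ⋯ + xₙ` with all `xᵢ ≥ 0` and
`v = T₁ x₁ + ⋯ + Tₙ xₙ` with all `Tᵢ ∈ A`. -/
inductive Reach (A : Set (Lob E F)) : E → F → Prop
  | zero : Reach A 0 0
  | step {x : E} {v : F} (z : E) (T : Lob E F) : Reach A x v → 0 ≤ z → T ∈ A →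
      Reach A (x + z) (v + T.1 z)

namespace Reach

variable {A : Set (Lob E F)}

theorem nonneg {x : E} {v : F} (h : Reach A x v) : 0 ≤ x := by
  induction h with
  | zero => exact le_rfl
  | step z T _ hz _ ih => exact add_nonneg ih hz

theorem single {x : E} (hx : 0 ≤ x) {T : Lob E F} (hT : T ∈ A) : Reach A x (T.1 x) := by
  simpa using Reach.step x T Reach.zero hx hT

theorem add {x y : E} {v w : F} (h : Reach A x v) (h' : Reach A y w) :
    Reach A (x + y) (v + w) := by
  induction h' with
  | zero => simpa using h
  | step z T _ hz hT ih =>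
    rw [← add_assoc, ← add_assoc]
    exact ih.step z T hz hT

theorem smul {x : E} {v : F} {c : ℝ} (hc : 0 ≤ c) (h : Reach A x v) :
    Reach A (c • x) (c • v) := by
  induction h with
  | zero => simpa using Reach.zero
  | step z T _ hz hT ih =>
    rw [smul_add, smul_add, ← map_smul]
    exact ih.step _ T (smul_nonneg hc hz) hT

theorem split {u : E} {v : F} (h : Reach A u v) :
    ∀ x y : E, 0 ≤ x → 0 ≤ y → u = x + y → ∃ a b, Reach A x a ∧ Reach A y b ∧ v = a + b := by
  induction h with
  | zero =>
    intro x y hx hy h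
    have hx0 : x = 0 := le_antisymm (by
      have : x ≤ x + y := le_add_of_nonneg_right hy
      rwa [← h] at this) hx
    have hy0 : y = 0 := by simpa [hx0] using h.symm
    subst hx0 hy0
    exact ⟨0, 0, Reach.zero, Reach.zero, by simp⟩
  | step z T h1 hz hT ih =>
    intro x y hx hy h
    obtain ⟨x₁, x₂, y₁, y₂, h1', h2', h3', h4', rfl, rfl, e1, e2⟩ :=
      decomp hx hy h1.nonneg hz h.symm
    obtain ⟨a, b, ha, hb, hab⟩ := ih x₁ y₁ h1' h3' e1
    refine ⟨a + T.1 x₂, b + T.1 y₂, ha.step x₂ T h2' hT, hb.step y₂ T h4' hT, ?_⟩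
    rw [hab, e2, map_add]
    abel

theorem le {x : E} {v : F} {U : Lob E F} (hU : U ∈ upperBounds A) (h : Reach A x v) :
    v ≤ U.1 x := by
  induction h with
  | zero => simp
  | step z T _ hz hT ih =>
    rw [map_add]
    exact add_le_add ih (hU hT z hz)

theorem pair {S T : Lob E F} {x : E} {v : F} (h : Reach {S, T} x v) :
    ∃ a b, 0 ≤ a ∧ 0 ≤ b ∧ x = a + b ∧ v = S.1 a + T.1 b := by
  induction h with
  | zero => exact ⟨0, 0, le_rfl, le_rfl, by simp, by simp⟩
  | step z U _ hz hU ih =>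
    obtain ⟨a, b, ha, hb, rfl, rfl⟩ := ih
    rcases hU with rfl | rfl
    · exact ⟨a + z, b, add_nonneg ha hz, hb, by abel, by rw [map_add]; abel⟩
    · exact ⟨a, b + z, ha, add_nonneg hb hz, by abel, by rw [map_add]; abel⟩

end Reach

end Operators

section RieszKantorovich

variable {E : Type u} [AddCommGroup E] [Lattice E] [IsOrderedAddMonoid E] [Module ℝ E]
  [IsOrderedModule ℝ E]
variable {F : Type v} [AddCommGroup F] [ConditionallyCompleteLattice F] [IsOrderedAddMonoid F]
  [Module ℝ F] [IsOrderedModule ℝ F]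

theorem Lob.exists_isLUB_aux {A : Set (Lob E F)} (hne : A.Nonempty)
    (hb : ∀ x : E, 0 ≤ x → BddAbove {v : F | Reach A x v}) :
    ∃ T : Lob E F, IsLUB A T ∧ ∀ x : E, 0 ≤ x → IsLUB {v : F | Reach A x v} (T.1 x) := by
  obtain ⟨S, hS⟩ := hne
  have hl : ∀ x : E, 0 ≤ x → IsLUB {v : F | Reach A x v} (sSup {v : F | Reach A x v}) :=
    fun x hx => isLUB_csSup ⟨_, Reach.single hx hS⟩ (hb x hx)
  have hsmul : ∀ (c : ℝ) x, 0 ≤ c → 0 ≤ x →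
      c • sSup {v : F | Reach A x v} ≤ sSup {v : F | Reach A (c • x) v} := by
    intro c x hc hx
    rcases hc.eq_or_lt with rfl | hc'
    · rw [zero_smul, zero_smul]
      exact (hl 0 le_rfl).1 Reach.zero
    · have : sSup {v : F | Reach A x v} ≤ c⁻¹ • sSup {v : F | Reach A (c • x) v} := by
        refine (hl x hx).2 fun v hv => ?_
        have := smul_le_smul_of_nonneg_left
          ((hl (c • x) (smul_nonneg hc hx)).1 (hv.smul hc)) (inv_nonneg.2 hc)
        simpa [smul_smul, inv_mul_cancel₀ hc'.ne'] using this
      have := smul_le_smul_of_nonneg_left this hc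
      simpa [smul_smul, mul_inv_cancel₀ hc'.ne'] using this
  obtain ⟨T, hT⟩ := exists_linear_extension (fun x : E => sSup {v : F | Reach A x v})
    (by
      intro x y hx hy
      apply le_antisymm
      · refine (hl _ (add_nonneg hx hy)).2 fun v hv => ?_
        obtain ⟨a, b, ha, hb, rfl⟩ := hv.split x y hx hy rfl
        exact add_le_add ((hl x hx).1 ha) ((hl y hy).1 hb)
      · rw [← le_sub_iff_add_le]
        refine (hl x hx).2 fun a ha => ?_
        rw [le_sub_comm]
        refine (hl y hy).2 fun b hb => ?_
        rw [le_sub_iff_add_le']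
        exact (hl _ (add_nonneg hx hy)).1 (ha.add hb))
    (by
      intro c x hc hx
      apply le_antisymm _ (hsmul c x hc hx)
      rcases hc.eq_or_lt with rfl | hc'
      · refine (hl _ (by simp)).2 fun v hv => ?_
        have h2 := hv.smul (A := A) (c := 0) le_rfl
        rw [zero_smul] at hv ⊢
        obtain ⟨a, b, ha, hb, h⟩ := hv.split 0 0 le_rfl le_rfl (by simp)
        have h0 : ∀ {z : E} {v : F}, Reach A z v → z = 0 → v = 0 := by
          intro z v h
          induction h with
          | zero => simp
          | step z T h1 hz hT ih =>
            intro h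
            have hz0 : z = 0 := le_antisymm (by
              have := le_add_of_nonneg_left (a := z) h1.nonneg
              rwa [h] at this) hz
            subst hz0
            rw [add_zero] at h
            simp [ih h]
        exact (h0 hv rfl).le
      · have := smul_le_smul_of_nonneg_left
          (hsmul c⁻¹ (c • x) (inv_nonneg.2 hc) (smul_nonneg hc hx)) hc
        simpa [smul_smul, mul_inv_cancel₀ hc'.ne', inv_mul_cancel₀ hc'.ne'] using this)
  have hl' : ∀ x : E, 0 ≤ x → IsLUB {v : F | Reach A x v} (T x) := fun x hx => by
    rw [hT x hx]; exact hl x hx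
  have hST : ∀ R ∈ A, ∀ x, 0 ≤ x → R.1 x ≤ T x := fun R hR x hx =>
    (hl' x hx).1 (Reach.single hx hR)
  have hTb : IsOrderBounded T := by
    rw [isOrderBounded_iff]
    intro x hx
    obtain ⟨c, hc⟩ := isOrderBounded_iff.1 S.2 x hx
    refine ⟨c + (T x - S.1 x), fun y h0 h1 => ?_⟩
    have h2 := hST S hS (x - y) (sub_nonneg.2 h1)
    rw [map_sub, map_sub] at h2
    have h3 : T y ≤ S.1 y + (T x - S.1 x) := by
      have h4 := add_le_add_left h2 (T y - S.1 x + S.1 y)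
      have e1 : S.1 x - S.1 y + (T y - S.1 x + S.1 y) = T y := by abel
      have e2 : T x - T y + (T y - S.1 x + S.1 y) = S.1 y + (T x - S.1 x) := by abel
      rwa [e1, e2] at h4
    exact h3.trans (add_le_add_left (hc y h0 h1) _)
  refine ⟨⟨T, hTb⟩, ⟨fun R hR x hx => hST R hR x hx, fun U hU x hx => ?_⟩, hl'⟩
  exact (hl' x hx).2 fun v hv => hv.le hU

theorem Lob.exists_isLUB {A : Set (Lob E F)} (hne : A.Nonempty) (hb : BddAbove A) :
    ∃ T : Lob E F, IsLUB A T := by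
  obtain ⟨U, hU⟩ := hb
  obtain ⟨T, hT, -⟩ := Lob.exists_isLUB_aux hne fun x _ => ⟨U.1 x, fun v hv => hv.le hU⟩
  exact ⟨T, hT⟩

theorem Lob.exists_isLUB_pair (S T : Lob E F) :
    ∃ U : Lob E F, IsLUB {S, T} U ∧
      ∀ x : E, 0 ≤ x → IsLUB {v : F | Reach {S, T} x v} (U.1 x) := by
  refine Lob.exists_isLUB_aux ⟨S, by simp⟩ fun x hx => ?_
  obtain ⟨c, hc⟩ := isOrderBounded_iff.1 S.2 x hx
  obtain ⟨d, hd⟩ := isOrderBounded_iff.1 T.2 x hx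
  refine ⟨c + d, fun v hv => ?_⟩
  obtain ⟨a, b, ha, hb, rfl, rfl⟩ := hv.pair
  exact add_le_add (hc a ha (le_add_of_nonneg_right hb)) (hd b hb (le_add_of_nonneg_left ha))

theorem Lob.isGLB_neg {A : Set (Lob E F)} {T : Lob E F} (h : IsLUB (-A) T) : IsGLB A (-T) := by
  constructor
  · intro S hS
    exact neg_le.1 (h.1 (by simpa using hS))
  · intro S hS
    refine le_neg.1 (h.2 fun R hR => ?_)
    exact le_neg.1 (hS hR)

theorem Lob.exists_isGLB {A : Set (Lob E F)} (hne : A.Nonempty) (hb : BddBelow A) :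
    ∃ T : Lob E F, IsGLB A T := by
  obtain ⟨T, hT⟩ := Lob.exists_isLUB (A := -A) hne.neg hb.neg
  exact ⟨-T, Lob.isGLB_neg hT⟩

theorem Lob.exists_isGLB_pair (S T : Lob E F) : ∃ U : Lob E F, IsGLB {S, T} U := by
  obtain ⟨U, hU, -⟩ := Lob.exists_isLUB_pair (-S) (-T)
  refine ⟨-U, Lob.isGLB_neg ?_⟩
  simpa [Set.neg_insert] using hU

open Classical in
/-- The order bounded operators into a Dedekind complete vector lattice form a Dedekind complete
vector lattice. -/
instance : ConditionallyCompleteLattice (Lob E F) where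
  sup S T := (Lob.exists_isLUB_pair S T).choose
  le_sup_left S T := (Lob.exists_isLUB_pair S T).choose_spec.1.1 (by simp)
  le_sup_right S T := (Lob.exists_isLUB_pair S T).choose_spec.1.1 (by simp)
  sup_le S T _ h h' := (Lob.exists_isLUB_pair S T).choose_spec.1.2 (by simp [h, h'])
  inf S T := (Lob.exists_isGLB_pair S T).choose
  inf_le_left S T := (Lob.exists_isGLB_pair S T).choose_spec.1 (by simp)
  inf_le_right S T := (Lob.exists_isGLB_pair S T).choose_spec.1 (by simp)
  le_inf _ S T h h' := (Lob.exists_isGLB_pair S T).choose_spec.2 (by simp [h, h'])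
  sSup A := if h : ∃ T, IsLUB A T then h.choose else 0
  sInf A := if h : ∃ T, IsGLB A T then h.choose else 0
  isLUB_csSup A hne hb := by
    have h := Lob.exists_isLUB hne hb
    simp only [h, dite_true]
    exact h.choose_spec
  isGLB_csInf A hne hb := by
    have h := Lob.exists_isGLB hne hb
    simp only [h, dite_true]
    exact h.choose_spec

theorem Lob.sup_zero_apply_le (T : Lob E F) {x : E} (hx : 0 ≤ x) {c : F}
    (hc : ∀ y, 0 ≤ y → y ≤ x → T.1 y ≤ c) : (T ⊔ 0).1 x ≤ c := by
  refine ((Lob.exists_isLUB_pair T 0).choose_spec.2 x hx).2 fun v hv => ?_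
  obtain ⟨a, b, ha, hb, rfl, rfl⟩ := hv.pair
  simpa using hc a ha (le_add_of_nonneg_right hb)

theorem Lob.mono {T : Lob E F} (hT : 0 ≤ T) {x y : E} (h : x ≤ y) : T.1 x ≤ T.1 y := by
  have h1 : 0 ≤ T.1 (y - x) := hT (y - x) (sub_nonneg.2 h)
  rw [map_sub] at h1
  exact sub_nonneg.1 h1

theorem Lob.abs_apply_le {T : Lob E F} (hT : 0 ≤ T) (x : E) : |T.1 x| ≤ T.1 |x| := by
  rw [abs_le', ← map_neg]
  exact ⟨Lob.mono hT (le_abs_self x), Lob.mono hT (neg_le_abs x)⟩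

/-- The positive part of an order continuous operator is order continuous. -/
theorem Lob.sup_zero_mem {T : Lob E F} (hT : IsOrderContinuous T.1) :
    IsOrderContinuous (T ⊔ 0).1 := by
  have hpos : (0 : Lob E F) ≤ T ⊔ 0 := le_sup_right
  intro ι _ _ _ x hx
  rw [orderConv_zero_iff] at hx ⊢
  obtain ⟨κ, _, _, _, y, hy, hy0, hxy⟩ := hx
  have hy0' : ∀ b, 0 ≤ y b := fun b => hy0.1 ⟨b, rfl⟩
  have hglb : IsGLB (Set.range fun b => (T ⊔ 0).1 (y b)) 0 := by
    refine ⟨?_, fun z hz => ?_⟩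
    · rintro _ ⟨b, rfl⟩
      exact hpos _ (hy0' b)
    obtain ⟨b₀⟩ := ‹Nonempty κ›
    have key : ∀ c, 0 ≤ c → c ≤ y b₀ → T.1 c ≤ (T ⊔ 0).1 (y b₀) - z := by
      intro c hc0 hc1
      have hconv : OrderConv (fun b => c ⊓ y b) 0 := by
        rw [orderConv_zero_iff]
        refine ⟨κ, inferInstance, inferInstance, ⟨b₀⟩, y, hy, hy0, fun b => ⟨b, fun a ha => ?_⟩⟩
        rw [abs_of_nonneg (le_inf hc0 (hy0' a))]
        exact inf_le_right.trans (hy ha)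
      have h1 := @hT κ _ _ ⟨b₀⟩ _ hconv
      rw [orderConv_zero_iff] at h1
      obtain ⟨κ', _, _, _, f, -, hf0, hf⟩ := h1
      have h2 : T.1 c - ((T ⊔ 0).1 (y b₀) - z) ≤ 0 := by
        refine hf0.2 ?_
        rintro _ ⟨k, rfl⟩
        obtain ⟨a₀, ha₀⟩ := hf k
        obtain ⟨a, ha1, ha2⟩ := exists_ge_ge a₀ b₀
        have h3 := (le_abs_self _).trans (ha₀ a ha1)
        have h4 : 0 ≤ c - c ⊓ y a := sub_nonneg.2 inf_le_left
        have h5 : c - c ⊓ y a ≤ y b₀ - y a := by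
          rw [sub_le_iff_le_add, ← sub_le_iff_le_add']
          refine le_inf ?_ ?_
          · rw [sub_le_comm, sub_self]
            exact sub_nonneg.2 (hy ha2)
          · rw [sub_le_comm]
            exact sub_le_sub_right hc1 _
        have h6 : T.1 (c - c ⊓ y a) ≤ (T ⊔ 0).1 (y b₀ - y a) :=
          ((le_sup_left : T ≤ T ⊔ 0) _ h4).trans (Lob.mono hpos h5)
        rw [map_sub, map_sub] at h6
        have h7 := hz ⟨a, rfl⟩
        have h8 := add_le_add (add_le_add h6 h7) h3
        refine sub_nonneg.1 ((sub_nonneg.2 h8).trans_eq ?_)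
        abel
      exact sub_nonpos.1 h2
    have h := Lob.sup_zero_apply_le T (hy0' b₀) key
    exact sub_nonneg.1 ((sub_nonneg.2 h).trans_eq (by abel))
  obtain ⟨b₀⟩ := ‹Nonempty κ›
  refine ⟨(Set.range fun b => (T ⊔ 0).1 (y b))ᵒᵈ, inferInstance, ⟨?_⟩,
    ⟨OrderDual.toDual ⟨_, b₀, rfl⟩⟩, fun z => (OrderDual.ofDual z).1, fun _ _ h => h, ?_, ?_⟩
  · rintro ⟨_, b, rfl⟩ ⟨_, c, rfl⟩
    obtain ⟨d, hd, hd'⟩ := exists_ge_ge b c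
    exact ⟨OrderDual.toDual ⟨_, d, rfl⟩, Lob.mono hpos (hy hd), Lob.mono hpos (hy hd')⟩
  · convert hglb using 1
    exact Subtype.range_coe
  · rintro ⟨_, b, rfl⟩
    obtain ⟨a₀, ha₀⟩ := hxy b
    exact ⟨a₀, fun a ha => (Lob.abs_apply_le hpos _).trans (Lob.mono hpos (ha₀ a ha))⟩

/-- The inclusion of `𝓛_oc(E, F)` into `𝓛_ob(E, F)`. -/
def Loc.toLob (T : Loc E F) : Lob E F := ⟨T.1, T.2.1⟩

theorem Loc.sup_mem (S T : Loc E F) : (S.toLob ⊔ T.toLob).1 ∈ orderCont E F := by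
  refine ⟨(S.toLob ⊔ T.toLob).2, ?_⟩
  rw [sup_eq_add_posPart_sub]
  exact ((orderCont E F).add_mem T.2
    ⟨((S.toLob - T.toLob) ⊔ 0).2, Lob.sup_zero_mem ((orderCont E F).sub_mem S.2 T.2).2⟩).2

theorem Loc.inf_mem (S T : Loc E F) : (S.toLob ⊓ T.toLob).1 ∈ orderCont E F := by
  refine ⟨(S.toLob ⊓ T.toLob).2, ?_⟩
  rw [inf_eq_sub_posPart_sub]
  exact ((orderCont E F).sub_mem S.2
    ⟨((S.toLob - T.toLob) ⊔ 0).2, Lob.sup_zero_mem ((orderCont E F).sub_mem S.2 T.2).2⟩).2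

/-- The order continuous operators form a vector sublattice of the order bounded operators. -/
instance : Lattice (Loc E F) where
  le S T := S.toLob ≤ T.toLob
  le_refl _ := le_refl (α := Lob E F) _
  le_trans _ _ _ h h' := le_trans (α := Lob E F) h h'
  le_antisymm S T h h' := by
    have h1 : S.toLob = T.toLob := le_antisymm (α := Lob E F) h h'
    exact Subtype.ext (congrArg (fun U : Lob E F => U.1) h1)
  sup S T := ⟨(S.toLob ⊔ T.toLob).1, Loc.sup_mem S T⟩
  le_sup_left _ _ := le_sup_left (α := Lob E F)
  le_sup_right _ _ := le_sup_right (α := Lob E F)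
  sup_le _ _ _ h h' := sup_le (α := Lob E F) h h'
  inf S T := ⟨(S.toLob ⊓ T.toLob).1, Loc.inf_mem S T⟩
  inf_le_left _ _ := inf_le_left (α := Lob E F)
  inf_le_right _ _ := inf_le_right (α := Lob E F)
  le_inf _ _ _ h h' := le_inf (α := Lob E F) h h'

instance : IsOrderedAddMonoid (Loc E F) where
  add_le_add_left S T h c := add_le_add_left (α := Lob E F) (show S.toLob ≤ T.toLob from h) c.toLob

instance : IsOrderedModule ℝ (Loc E F) where
  smul_le_smul_of_nonneg_left _ hc _ _ h x hx := smul_le_smul_of_nonneg_left (h x hx) hc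
  smul_le_smul_of_nonneg_right _ hT _ _ h x hx := smul_le_smul_of_nonneg_right h (hT x hx)

end RieszKantorovich

end VLat

end

/-! A linear map is a lattice homomorphism once it commutes with positive parts. Since `T ↦ ρ_T` and
`T ↦ λ_T` are positive, only the upper estimates matter: for `S, x ≥ 0`, with `U` the positive part
of `ρ_T` or of `λ_T`, that `S (T⁺ x)`, respectively `T⁺ (S x)`, is at most `(U S) x`. Whenever `0 ≤
R ≤ S`, the product of `T` with `R` is at most `U R ≤ U S`, so it suffices to find enough operators
`R` below `S`.

For `λ`, `T⁺ (S x)` is the supremum of `T y` over `0 ≤ y ≤ S x`. A Freudenthal-type approximation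
puts `y` uniformly close to `M (S x)` with `0 ≤ M ≤ 1`, and `R = M S` serves
(`Lob.comp_posPart_apply_le`). For `ρ`, band projections `P` with `P (T z) = (T z)⁺` give `R = S P`,
hence `S (T z)⁺ ≤ (U S) z`. The sums of `(T xᵢ)⁺` over decompositions of `x` increase to `T⁺ x`, and
order continuity of `S` passes to the limit (`Loc.comp_posPart_apply_le`).

The order continuity claims rest on one fact: a net of operators decreasing to `0`, in `𝓛_ob` or in
`𝓛_oc`, decreases to `0` at each positive vector. -/

noncomputable section
namespace VLat

/-! ### Archimedean property, band projections and dyadic approximation -/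

section DedekindComplete

variable {E : Type u} [AddCommGroup E] [ConditionallyCompleteLattice E] [IsOrderedAddMonoid E]

/-- The supremum `s` of the multiples also dominates their shift by `x`, so `s ≤ s - x`. -/
theorem nonpos_of_forall_nsmul_le {x y : E} (h : ∀ n : ℕ, n • x ≤ y) : x ≤ 0 := by
  have hb : BddAbove (Set.range fun n : ℕ => n • x) := ⟨y, by rintro _ ⟨n, rfl⟩; exact h n⟩
  have h1 : (⨆ n : ℕ, n • x) ≤ (⨆ n : ℕ, n • x) - x := by
    refine ciSup_le fun n => ?_
    rw [le_sub_iff_add_le, ← succ_nsmul]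
    exact le_ciSup hb (n + 1)
  exact sub_nonneg.1 ((sub_nonneg.2 h1).trans_eq (by abel))

variable [Module ℝ E] [IsOrderedModule ℝ E]

theorem nonpos_of_forall_le_inv_two_pow_smul {x y : E} (hy : 0 ≤ y)
    (h : ∀ n : ℕ, x ≤ ((2 : ℝ)⁻¹ ^ n) • y) : x ≤ 0 := by
  refine nonpos_of_forall_nsmul_le (y := y) fun n => ?_
  rw [← Nat.cast_smul_eq_nsmul ℝ]
  refine (smul_le_smul_of_nonneg_left (h n) n.cast_nonneg).trans ?_
  rw [smul_smul]
  conv_rhs => rw [← one_smul ℝ y]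
  refine smul_le_smul_of_nonneg_right ?_ hy
  rw [inv_pow, ← div_eq_mul_inv, div_le_one (by positivity)]
  exact_mod_cast Nat.lt_two_pow_self.le

theorem inf_add_le_inf_add_inf {x y z : E} (hx : 0 ≤ x) (hy : 0 ≤ y) (hz : 0 ≤ z) :
    z ⊓ (x + y) ≤ z ⊓ x + z ⊓ y := by
  rw [inf_add, add_inf, add_inf]
  refine le_inf (le_inf ?_ ?_) (le_inf ?_ inf_le_right)
  · exact inf_le_left.trans (le_add_of_nonneg_left hz)
  · exact inf_le_left.trans (le_add_of_nonneg_right hy)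
  · exact inf_le_left.trans (le_add_of_nonneg_left hx)

/-- The band projection onto the band generated by `a⁺` maps `a` to `a⁺`. -/
theorem exists_linearMap_apply_eq_posPart (a : E) :
    ∃ P : E →ₗ[ℝ] E, (∀ x, 0 ≤ x → 0 ≤ P x) ∧ (∀ x, 0 ≤ x → P x ≤ x) ∧ P a = a⁺ := by
  -- For `y ≥ 0` the supremum of `B y` is that of `y ⊓ t • a⁺` over `t ≥ 0`, the usual formula for
  -- the band projection. Elements of `B y` need not be positive, which makes superadditivity
  -- immediate.
  let B : E → Set E := fun y => {v | v ≤ y ∧ ∃ t : ℝ, 0 ≤ t ∧ v ≤ t • a⁺}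
  have h0 : ∀ y, 0 ≤ y → (0 : E) ∈ B y := fun y hy => ⟨hy, 0, le_rfl, by simp⟩
  have hl : ∀ y, 0 ≤ y → IsLUB (B y) (sSup (B y)) := fun y hy =>
    isLUB_csSup ⟨0, h0 y hy⟩ ⟨y, fun v hv => hv.1⟩
  have hsmul : ∀ (c : ℝ) y, 0 < c → 0 ≤ y → c • sSup (B y) ≤ sSup (B (c • y)) := by
    intro c y hc hy
    have : sSup (B y) ≤ c⁻¹ • sSup (B (c • y)) := by
      refine (hl y hy).2 ?_
      rintro v ⟨hv, t, ht, hvt⟩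
      have h1 : c • v ∈ B (c • y) := ⟨smul_le_smul_of_nonneg_left hv hc.le, c * t,
        mul_nonneg hc.le ht, by rw [mul_smul]; exact smul_le_smul_of_nonneg_left hvt hc.le⟩
      have := smul_le_smul_of_nonneg_left ((hl (c • y) (smul_nonneg hc.le hy)).1 h1)
        (inv_nonneg.2 hc.le)
      simpa [smul_smul, inv_mul_cancel₀ hc.ne'] using this
    have := smul_le_smul_of_nonneg_left this hc.le
    simpa [smul_smul, mul_inv_cancel₀ hc.ne'] using this
  obtain ⟨P, hP⟩ := exists_linear_extension (fun y => sSup (B y))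
    (by
      intro x y hx hy
      apply le_antisymm
      · refine (hl _ (add_nonneg hx hy)).2 ?_
        rintro v ⟨hv, t, ht, hvt⟩
        -- Passing to `v⁺` keeps both bounds and allows `v⁺` to be cut into a piece below `x` and a
        -- piece below `y`.
        have hv' : v⁺ ≤ x + y := sup_le hv (add_nonneg hx hy)
        have hvt' : v⁺ ≤ t • a⁺ := sup_le hvt (smul_nonneg ht (posPart_nonneg a))
        have h1 := inf_add_le_inf_add_inf hx hy (posPart_nonneg v)
        rw [inf_eq_left.2 hv'] at h1
        exact (le_posPart v).trans (h1.trans (add_le_add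
          ((hl x hx).1 ⟨inf_le_right, t, ht, inf_le_left.trans hvt'⟩)
          ((hl y hy).1 ⟨inf_le_right, t, ht, inf_le_left.trans hvt'⟩)))
      · rw [← le_sub_iff_add_le]
        refine (hl x hx).2 ?_
        rintro v ⟨hv, t, ht, hvt⟩
        rw [le_sub_comm]
        refine (hl y hy).2 ?_
        rintro w ⟨hw, s, hs, hws⟩
        rw [le_sub_iff_add_le']
        exact (hl _ (add_nonneg hx hy)).1 ⟨add_le_add hv hw, t + s, add_nonneg ht hs, by
          rw [add_smul]; exact add_le_add hvt hws⟩)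
    (by
      intro c y hc hy
      rcases hc.eq_or_lt with rfl | hc'
      · rw [zero_smul, zero_smul]
        exact le_antisymm ((hl 0 le_rfl).2 fun v hv => hv.1) ((hl 0 le_rfl).1 (h0 0 le_rfl))
      · refine le_antisymm ?_ (hsmul c y hc' hy)
        have := smul_le_smul_of_nonneg_left
          (hsmul c⁻¹ (c • y) (inv_pos.2 hc') (smul_nonneg hc hy)) hc
        simpa [smul_smul, mul_inv_cancel₀ hc'.ne', inv_mul_cancel₀ hc'.ne'] using this)
  refine ⟨P, fun x hx => ?_, fun x hx => ?_, ?_⟩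
  · rw [hP x hx]
    exact (hl x hx).1 (h0 x hx)
  · rw [hP x hx]
    exact (hl x hx).2 fun v hv => hv.1
  · have h1 : P a⁺ = a⁺ := by
      rw [hP _ (posPart_nonneg a)]
      exact le_antisymm ((hl _ (posPart_nonneg a)).2 fun v hv => hv.1)
        ((hl _ (posPart_nonneg a)).1 ⟨le_rfl, 1, zero_le_one, by simp⟩)
    have h2 : P a⁻ = 0 := by
      rw [hP _ (negPart_nonneg a)]
      refine le_antisymm ((hl _ (negPart_nonneg a)).2 ?_)
        ((hl _ (negPart_nonneg a)).1 (h0 _ (negPart_nonneg a)))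
      rintro v ⟨hv, t, ht, hvt⟩
      -- Dividing by `t + 1` instead of `t` allows `t = 0` and keeps the factor at most `1`, as the
      -- bound by `a⁻` requires.
      have ht1 : 0 < t + 1 := by linarith
      have h3 : (t + 1)⁻¹ • v⁺ ≤ a⁺ ⊓ a⁻ := by
        refine le_inf ?_ ?_
        · have h4 : v⁺ ≤ (t + 1) • a⁺ := by
            refine sup_le (hvt.trans ?_) (smul_nonneg ht1.le (posPart_nonneg a))
            exact smul_le_smul_of_nonneg_right (by linarith) (posPart_nonneg a)
          have := smul_le_smul_of_nonneg_left h4 (inv_nonneg.2 ht1.le)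
          simpa [smul_smul, inv_mul_cancel₀ ht1.ne'] using this
        · have h4 : (t + 1)⁻¹ • v⁺ ≤ (1 : ℝ) • v⁺ :=
            smul_le_smul_of_nonneg_right (inv_le_one_of_one_le₀ (by linarith)) (posPart_nonneg v)
          rw [one_smul] at h4
          exact h4.trans (sup_le hv (negPart_nonneg a))
      rw [posPart_inf_negPart_eq_zero] at h3
      have h4 := smul_le_smul_of_nonneg_left h3 ht1.le
      rw [smul_smul, mul_inv_cancel₀ ht1.ne', one_smul, smul_zero] at h4
      exact (le_posPart v).trans h4
    conv_lhs => rw [← posPart_sub_negPart a]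
    rw [map_sub, h1, h2, sub_zero]

/-- A dyadic form of Freudenthal's theorem: every `y` between `0` and `w` is approximated uniformly
by values at `w` of operators between `0` and the identity. -/
theorem exists_linearMap_approx (n : ℕ) : ∀ y w : E, 0 ≤ y → y ≤ w →
    ∃ M : E →ₗ[ℝ] E, (∀ x, 0 ≤ x → 0 ≤ M x) ∧ (∀ x, 0 ≤ x → M x ≤ x) ∧
      M w ≤ y ∧ y - M w ≤ ((2 : ℝ)⁻¹ ^ n) • w := by
  induction n with
  | zero =>
    intro y w hy hyw
    exact ⟨0, by simp, by simp, by simpa using hy, by simpa using hyw⟩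
  | succ n ih =>
    intro y w hy hyw
    -- `P` selects the part where `2y` exceeds `w`, the first binary digit of `y` relative to `w`.
    -- The remainder `2y - P w` lies again between `0` and `w`, and `y` is the average of `P w` and
    -- this remainder, so each digit halves the error.
    obtain ⟨P, hP0, hP1, hPa⟩ := exists_linearMap_apply_eq_posPart ((2 : ℝ) • y - w)
    have hPa' := hPa
    rw [map_sub, map_smul] at hPa'
    have h1 : 0 ≤ (2 : ℝ) • y - P w := by
      have e : (2 : ℝ) • y - P w = ((2 : ℝ) • y - w)⁺ + (2 : ℝ) • (y - P y) := by
        rw [← hPa', smul_sub]; abel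
      rw [e]
      exact add_nonneg (posPart_nonneg _) (smul_nonneg zero_le_two (sub_nonneg.2 (hP1 y hy)))
    have h2 : (2 : ℝ) • y - P w ≤ w := by
      have e : w - ((2 : ℝ) • y - P w) = (2 : ℝ) • P (w - y) + ((2 : ℝ) • y - w)⁻ := by
        have e1 := posPart_sub_negPart ((2 : ℝ) • y - w)
        rw [← hPa', sub_eq_iff_eq_add, ← sub_eq_iff_eq_add'] at e1
        rw [← e1, map_sub, smul_sub, two_smul ℝ (P w)]
        abel
      rw [← sub_nonneg, e]
      exact add_nonneg (smul_nonneg zero_le_two (hP0 _ (sub_nonneg.2 hyw))) (negPart_nonneg _)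
    obtain ⟨M, hM0, hM1, hM2, hM3⟩ := ih _ _ h1 h2
    have h2' : (0 : ℝ) ≤ 2⁻¹ := by norm_num
    have hy2 : y = (2 : ℝ)⁻¹ • ((2 : ℝ) • y) := by simp [smul_smul]
    refine ⟨(2 : ℝ)⁻¹ • (P + M), fun x hx => smul_nonneg h2' (add_nonneg (hP0 x hx) (hM0 x hx)),
      fun x hx => ?_, ?_, ?_⟩
    · have := smul_le_smul_of_nonneg_left (add_le_add (hP1 x hx) (hM1 x hx)) h2'
      rw [← two_smul ℝ x, smul_smul, inv_mul_cancel₀ two_ne_zero, one_smul] at this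
      exact this
    · rw [hy2]
      refine smul_le_smul_of_nonneg_left ?_ h2'
      exact le_sub_iff_add_le'.1 hM2
    · have := smul_le_smul_of_nonneg_left hM3 h2'
      rw [smul_smul, ← pow_succ'] at this
      refine le_trans (le_of_eq ?_) this
      conv_lhs => rw [hy2]
      rw [LinearMap.smul_apply, LinearMap.add_apply, ← smul_sub, sub_sub]

end DedekindComplete

/-! ### Order continuity of positive operators -/

section Positive

variable {E : Type u} [AddCommGroup E] [Lattice E] [IsOrderedAddMonoid E] [Module ℝ E]
variable {F : Type u} [AddCommGroup F] [Lattice F] [IsOrderedAddMonoid F] [Module ℝ F]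

theorem map_le_map_of_pos {R : E →ₗ[ℝ] F} (hR : ∀ x, 0 ≤ x → 0 ≤ R x) {x y : E} (h : x ≤ y) :
    R x ≤ R y := by
  have := hR _ (sub_nonneg.2 h)
  rwa [map_sub, sub_nonneg] at this

theorem isOrderBounded_of_pos {R : E →ₗ[ℝ] F} (hR : ∀ x, 0 ≤ x → 0 ≤ R x) : IsOrderBounded R :=
  isOrderBounded_iff.2 fun x _ => ⟨R x, fun _ _ hy => map_le_map_of_pos hR hy⟩

/-- The image under `R` of a dominating net dominates the image net. It keeps its index type, which
is admissible in `F` because both spaces live in the same universe. -/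
theorem isOrderContinuous_of_pos {R : E →ₗ[ℝ] F} (hR : ∀ x, 0 ≤ x → 0 ≤ R x)
    (h : ∀ (κ : Type u) [Preorder κ] [IsDirectedOrder κ] [Nonempty κ] (y : κ → E), Antitone y →
      IsGLB (Set.range y) 0 → ∀ l, (∀ b, l ≤ R (y b)) → l ≤ 0) : IsOrderContinuous R := by
  intro ι _ _ _ x hx
  rw [orderConv_zero_iff] at hx ⊢
  obtain ⟨κ, _, _, _, y, hy, hy0, hxy⟩ := hx
  refine ⟨κ, inferInstance, inferInstance, inferInstance, fun b => R (y b),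
    fun a b hab => map_le_map_of_pos hR (hy hab), ⟨?_, fun l hl => ?_⟩, fun b => ?_⟩
  · rintro _ ⟨b, rfl⟩
    exact hR _ (hy0.1 ⟨b, rfl⟩)
  · exact h κ y hy hy0 l fun b => hl ⟨b, rfl⟩
  · obtain ⟨a₀, ha₀⟩ := hxy b
    refine ⟨a₀, fun a ha => abs_le'.2 ⟨?_, ?_⟩⟩
    · exact map_le_map_of_pos hR ((le_abs_self _).trans (ha₀ a ha))
    · rw [← map_neg]
      exact map_le_map_of_pos hR ((neg_le_abs _).trans (ha₀ a ha))

/-- A decreasing net with infimum `0` dominates itself, hence is order convergent to `0`. Positivity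
of `R` is not needed. -/
theorem IsOrderContinuous.nonpos_of_forall_le {R : E →ₗ[ℝ] F} (hR : IsOrderContinuous R)
    {κ : Type u} [Preorder κ] [IsDirectedOrder κ] [Nonempty κ] {y : κ → E} (hy : Antitone y)
    (hy0 : IsGLB (Set.range y) 0) {l : F} (hl : ∀ b, l ≤ R (y b)) : l ≤ 0 := by
  have h : OrderConv y 0 := orderConv_zero_iff.2 ⟨κ, inferInstance, inferInstance, inferInstance,
    y, hy, hy0, fun b => ⟨b, fun a ha => by
      rw [abs_of_nonneg (hy0.1 ⟨a, rfl⟩)]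
      exact hy ha⟩⟩
  obtain ⟨κ', _, _, _, f, -, hf0, hf⟩ := orderConv_zero_iff.1 (hR κ y h)
  refine hf0.2 ?_
  rintro _ ⟨k, rfl⟩
  obtain ⟨a, ha⟩ := hf k
  exact (hl a).trans ((le_abs_self _).trans (ha a le_rfl))

theorem isOrderContinuous_of_le {R S : E →ₗ[ℝ] F} (hR : ∀ x, 0 ≤ x → 0 ≤ R x)
    (hRS : ∀ x, 0 ≤ x → R x ≤ S x) (hS : IsOrderContinuous S) : IsOrderContinuous R :=
  isOrderContinuous_of_pos hR fun _ _ _ _ _ hy hy0 _ hl =>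
    hS.nonpos_of_forall_le hy hy0 fun b => (hl b).trans (hRS _ (hy0.1 ⟨b, rfl⟩))

theorem isLatticeHom_of_map_sup_zero {R : E →ₗ[ℝ] F} (h : ∀ x, R (x ⊔ 0) = R x ⊔ 0) :
    IsLatticeHom R := by
  intro x y
  constructor
  · rw [sup_eq_add_posPart_sub, sup_eq_add_posPart_sub, map_add, posPart_def, posPart_def, h,
      map_sub]
  · rw [inf_eq_sub_posPart_sub, inf_eq_sub_posPart_sub, map_sub, posPart_def, posPart_def, h,
      map_sub]

end Positive

/-! ### Decreasing nets of operators -/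

section Nets

variable {E : Type u} [AddCommGroup E] [Lattice E] [IsOrderedAddMonoid E] [Module ℝ E]
  [IsOrderedModule ℝ E]
variable {F : Type u} [AddCommGroup F] [ConditionallyCompleteLattice F] [IsOrderedAddMonoid F]
  [Module ℝ F] [IsOrderedModule ℝ F]

/-- A decreasing net of positive operators has an infimum, and it is the pointwise infimum on the
positive cone. -/
theorem Lob.exists_isGLB_pointwise {κ : Type w} [Preorder κ] [IsDirectedOrder κ] [Nonempty κ]
    {V : κ → Lob E F} (hV : Antitone V) (hV0 : ∀ b, 0 ≤ V b) :
    ∃ Q : Lob E F, 0 ≤ Q ∧ (∀ b, Q ≤ V b) ∧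
      ∀ x, 0 ≤ x → ∀ l, (∀ b, l ≤ (V b).1 x) → l ≤ Q.1 x := by
  -- Along a decreasing net, finitely many indices may be replaced by one later index. So the sums
  -- in the Riesz–Kantorovich formula for the supremum of the `-V b` are dominated by single values
  -- `-(V b) x`.
  have key : ∀ {x : E} {v : F}, Reach (Set.range fun b => -V b) x v → ∃ b, v ≤ -(V b).1 x := by
    intro x v h
    induction h with
    | zero => exact ⟨Classical.arbitrary κ, by simp⟩
    | step z T h1 hz hT ih =>
      obtain ⟨b, hb⟩ := ih
      obtain ⟨c, rfl⟩ := hT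
      obtain ⟨d, hbd, hcd⟩ := exists_ge_ge b c
      refine ⟨d, ?_⟩
      rw [map_add, neg_add]
      exact add_le_add (hb.trans (neg_le_neg (hV hbd _ h1.nonneg))) (neg_le_neg (hV hcd z hz))
  obtain ⟨T, hT, hTx⟩ := Lob.exists_isLUB_aux (A := Set.range fun b => -V b)
    (Set.range_nonempty _) fun x hx => ⟨0, fun v hv => by
      obtain ⟨b, hb⟩ := key hv
      exact hb.trans (neg_nonpos.2 (hV0 b x hx))⟩
  refine ⟨-T, ?_, fun b => ?_, fun x hx l hl => ?_⟩
  · refine neg_nonneg.2 (hT.2 ?_)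
    rintro _ ⟨b, rfl⟩
    exact neg_nonpos.2 (hV0 b)
  · exact neg_le.1 (hT.1 ⟨b, rfl⟩)
  · refine le_neg.1 ((hTx x hx).2 fun v hv => ?_)
    obtain ⟨b, hb⟩ := key hv
    exact hb.trans (neg_le_neg (hl b))

theorem Lob.nonpos_of_forall_le_apply {κ : Type w} [Preorder κ] [IsDirectedOrder κ] [Nonempty κ]
    {V : κ → Lob E F} (hV : Antitone V) (hV0 : IsGLB (Set.range V) 0) {x : E} (hx : 0 ≤ x) {l : F}
    (hl : ∀ b, l ≤ (V b).1 x) : l ≤ 0 := by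
  obtain ⟨Q, -, hQ, hQx⟩ := Lob.exists_isGLB_pointwise hV fun b => hV0.1 ⟨b, rfl⟩
  have h : Q ≤ 0 := hV0.2 (by rintro _ ⟨b, rfl⟩; exact hQ b)
  exact (hQx x hx l hl).trans (h x hx)

/-- The pointwise infimum lies below an order continuous operator, so it is order continuous itself
and competes for the infimum within `𝓛_oc`. -/
theorem Loc.nonpos_of_forall_le_apply {κ : Type w} [Preorder κ] [IsDirectedOrder κ] [Nonempty κ]
    {V : κ → Loc E F} (hV : Antitone V) (hV0 : IsGLB (Set.range V) 0) {x : E} (hx : 0 ≤ x) {l : F}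
    (hl : ∀ b, l ≤ (V b).1 x) : l ≤ 0 := by
  obtain ⟨Q, hQ0, hQ, hQx⟩ := Lob.exists_isGLB_pointwise (V := fun b => (V b).toLob)
    (fun a b hab => hV hab) fun b => (hV0.1 ⟨b, rfl⟩ : 0 ≤ V b)
  have hQc : IsOrderContinuous Q.1 :=
    isOrderContinuous_of_le hQ0 (hQ (Classical.arbitrary κ)) (V (Classical.arbitrary κ)).2.2
  have h : (⟨Q.1, Q.2, hQc⟩ : Loc E F) ≤ 0 := hV0.2 (by rintro _ ⟨b, rfl⟩; exact hQ b)
  exact (hQx x hx l hl).trans (h x hx)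

end Nets

/-! ### Positive parts under composition -/

section Composition

variable {E : Type u} [AddCommGroup E] [ConditionallyCompleteLattice E] [IsOrderedAddMonoid E]
  [Module ℝ E] [IsOrderedModule ℝ E]

theorem IsOrderBounded.comp {T S : E →ₗ[ℝ] E} (hT : IsOrderBounded T) (hS : IsOrderBounded S) :
    IsOrderBounded (T ∘ₗ S) := by
  intro s h1 h2
  have := hT _ (hS s h1 h2).1 (hS s h1 h2).2
  rwa [← Set.image_comp] at this

/-- In the application `W` is `(λ_T ⊔ 0) S`; only its domination of `T R` for `0 ≤ R ≤ S` enters. -/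
theorem Lob.comp_posPart_apply_le {S T W : Lob E E} (hS : 0 ≤ S) {x : E} (hx : 0 ≤ x)
    (h : ∀ R : Lob E E, 0 ≤ R → R ≤ S → ∀ x, 0 ≤ x → T.1 (R.1 x) ≤ W.1 x) :
    (T ⊔ 0).1 (S.1 x) ≤ W.1 x := by
  have hT0 : 0 ≤ T ⊔ 0 := le_sup_right
  have hSx : 0 ≤ S.1 x := hS x hx
  refine Lob.sup_zero_apply_le T hSx fun y hy0 hy1 => ?_
  refine sub_nonpos.1 (nonpos_of_forall_le_inv_two_pow_smul (hT0 _ hSx) fun n => ?_)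
  -- `R = M S` controls `T (M (S x))`; the error `T (y - M (S x))` is at most `2⁻ⁿ T⁺ (S x)`, which
  -- vanishes by the Archimedean property.
  obtain ⟨M, hM0, hM1, hM2, hM3⟩ := exists_linearMap_approx n y (S.1 x) hy0 hy1
  have hR0 : ∀ z, 0 ≤ z → 0 ≤ (M ∘ₗ S.1) z := fun z hz => hM0 _ (hS z hz)
  have h1 : T.1 (M (S.1 x)) ≤ W.1 x := h ⟨M ∘ₗ S.1, isOrderBounded_of_pos hR0⟩ hR0
    (fun z hz => hM1 _ (hS z hz)) x hx
  have h2 : T.1 (y - M (S.1 x)) ≤ ((2 : ℝ)⁻¹ ^ n) • (T ⊔ 0).1 (S.1 x) := by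
    rw [← map_smul]
    exact ((le_sup_left : T ≤ T ⊔ 0) _ (sub_nonneg.2 hM2)).trans (Lob.mono hT0 hM3)
  rw [map_sub] at h2
  exact (sub_le_sub_left h1 _).trans h2

/-- `PosReach T x v`: one can write `x = x₁ + ⋯ + xₙ` with all `xᵢ ≥ 0` and
`v = (T x₁)⁺ + ⋯ + (T xₙ)⁺`. -/
inductive PosReach (T : E →ₗ[ℝ] E) : E → E → Prop
  | zero : PosReach T 0 0
  | step {x v : E} (z : E) : PosReach T x v → 0 ≤ z → PosReach T (x + z) (v + (T z)⁺)

namespace PosReach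

variable {T : E →ₗ[ℝ] E}

theorem nonneg {x v : E} (h : PosReach T x v) : 0 ≤ x := by
  induction h with
  | zero => exact le_rfl
  | step z _ hz ih => exact add_nonneg ih hz

theorem single {x : E} (hx : 0 ≤ x) : PosReach T x (T x)⁺ := by
  simpa using PosReach.zero.step x hx

theorem add {x y v w : E} (h : PosReach T x v) (h' : PosReach T y w) :
    PosReach T (x + y) (v + w) := by
  induction h' with
  | zero => simpa using h
  | step z _ hz ih =>
    rw [← add_assoc, ← add_assoc]
    exact ih.step z hz

theorem posPart_le {x v : E} (h : PosReach T x v) : (T x)⁺ ≤ v := by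
  induction h with
  | zero => simp
  | @step x v z _ hz ih =>
    rw [map_add]
    exact sup_le (add_le_add ((le_posPart _).trans ih) (le_posPart _))
      (add_nonneg ((posPart_nonneg _).trans ih) (posPart_nonneg _))

/-- Only an inequality survives: cutting a piece `z = x₂ + y₂` can increase the sum, as `(T z)⁺ ≤ (T
x₂)⁺ + (T y₂)⁺`. -/
theorem split {u v : E} (h : PosReach T u v) : ∀ x y : E, 0 ≤ x → 0 ≤ y → u = x + y →
    ∃ a b, PosReach T x a ∧ PosReach T y b ∧ v ≤ a + b := by
  induction h with
  | zero =>
    intro x y hx hy h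
    obtain ⟨rfl, rfl⟩ := (add_eq_zero_iff_of_nonneg hx hy).1 h.symm
    exact ⟨0, 0, PosReach.zero, PosReach.zero, by simp⟩
  | @step u v z h1 hz ih =>
    intro x y hx hy h
    obtain ⟨x₁, x₂, y₁, y₂, h1', h2', h3', h4', rfl, rfl, e1, e2⟩ :=
      decomp hx hy h1.nonneg hz h.symm
    obtain ⟨a, b, ha, hb, hab⟩ := ih x₁ y₁ h1' h3' e1
    refine ⟨_, _, ha.step x₂ h2', hb.step y₂ h4', ?_⟩
    rw [add_add_add_comm]
    exact add_le_add hab (((single h2').add (single h4')).posPart_le.trans' (by rw [e2]))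

/-- Two decompositions of `x` have a common refinement by the Riesz decomposition property, and
refining does not decrease the sum. -/
theorem directed {x v : E} (h : PosReach T x v) :
    ∀ w, PosReach T x w → ∃ u, PosReach T x u ∧ v ≤ u ∧ w ≤ u := by
  induction h with
  | zero =>
    intro w hw
    exact ⟨w, hw, by simpa using hw.posPart_le, le_rfl⟩
  | @step x v z h1 hz ih =>
    intro w hw
    obtain ⟨a, b, ha, hb, hab⟩ := hw.split x z h1.nonneg hz rfl
    obtain ⟨u, hu, hvu, hau⟩ := ih a ha
    exact ⟨u + b, hu.add hb, add_le_add hvu hb.posPart_le, hab.trans (add_le_add_left hau b)⟩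

theorem map_le {x v : E} (h : PosReach T x v) {S W : E →ₗ[ℝ] E}
    (hS : ∀ z, 0 ≤ z → S (T z)⁺ ≤ W z) : S v ≤ W x := by
  induction h with
  | zero => simp
  | step z _ hz ih =>
    rw [map_add, map_add]
    exact add_le_add ih (hS z hz)

end PosReach

theorem isLUB_posReach (T : Lob E E) {x : E} (hx : 0 ≤ x) :
    IsLUB {v | PosReach T.1 x v} ((T ⊔ 0).1 x) := by
  refine ⟨fun v hv => ?_, fun c hc => ?_⟩
  · refine hv.map_le (S := LinearMap.id) fun z hz => sup_le ?_ ?_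
    · exact (le_sup_left : T ≤ T ⊔ 0) z hz
    · exact (le_sup_right : 0 ≤ T ⊔ 0) z hz
  · refine Lob.sup_zero_apply_le T hx fun y hy0 hy1 => ?_
    -- The two-piece decomposition `x = y + (x - y)` already gives a sum above `T y`.
    have h := (PosReach.single (T := T.1) hy0).add (PosReach.single (sub_nonneg.2 hy1))
    rw [add_sub_cancel] at h
    exact ((le_posPart _).trans (le_add_of_nonneg_right (posPart_nonneg _))).trans (hc h)

theorem Loc.comp_posPart_apply_le {S : Loc E E} {T W : Lob E E} (hS : 0 ≤ S) {x : E} (hx : 0 ≤ x)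
    (h : ∀ R : Loc E E, 0 ≤ R → R ≤ S → ∀ x, 0 ≤ x → R.1 (T.1 x) ≤ W.1 x) :
    S.1 ((T ⊔ 0).1 x) ≤ W.1 x := by
  have h1 : ∀ z, 0 ≤ z → S.1 (T.1 z)⁺ ≤ W.1 z := by
    intro z hz
    -- `R = S P` lies below `S`, hence is order continuous, and `R (T z) = S (T z)⁺`.
    obtain ⟨P, hP0, hP1, hPa⟩ := exists_linearMap_apply_eq_posPart (T.1 z)
    have hR0 : ∀ y, 0 ≤ y → 0 ≤ (S.1 ∘ₗ P) y := fun y hy => hS _ (hP0 y hy)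
    have hR1 : ∀ y, 0 ≤ y → (S.1 ∘ₗ P) y ≤ S.1 y := fun y hy => map_le_map_of_pos hS (hP1 y hy)
    have := h ⟨S.1 ∘ₗ P, isOrderBounded_of_pos hR0, isOrderContinuous_of_le hR0 hR1 S.2.2⟩
      hR0 hR1 z hz
    rwa [← hPa]
  have hl := isLUB_posReach T hx
  let D : Type u := {v : E // PosReach T.1 x v}
  have : IsDirectedOrder D := ⟨fun a b => by
    obtain ⟨u, hu, hau, hbu⟩ := a.2.directed b.1 b.2
    exact ⟨⟨u, hu⟩, hau, hbu⟩⟩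
  have : Nonempty D := ⟨⟨_, PosReach.single hx⟩⟩
  -- The net `T⁺ x - v`, indexed by the sums `v` themselves, decreases to `0`, while `S v ≤ W x`
  -- makes `S (T⁺ x) - W x` a lower bound of its image under `S`.
  refine sub_nonpos.1 (S.2.2.nonpos_of_forall_le (κ := D) (y := fun v => (T ⊔ 0).1 x - v.1)
    (fun a b (hab : a.1 ≤ b.1) => sub_le_sub_left hab _) ⟨?_, fun l hlb => ?_⟩ fun v => ?_)
  · rintro _ ⟨v, rfl⟩
    exact sub_nonneg.2 (hl.1 v.2)
  · refine (le_sub_self_iff _).1 (hl.2 fun v hv => ?_)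
    exact le_sub_comm.1 (hlb ⟨⟨v, hv⟩, rfl⟩)
  · rw [map_sub]
    exact sub_le_sub_left (v.2.map_le h1) _

/-! ### The multiplication operators -/

variable (E) in
/-- `T ↦ (S ↦ S T)` for `T ∈ 𝓛_ob(E)` and `S ∈ 𝓛_oc(E)`. -/
def compRight : Lob E E →ₗ[ℝ] Loc E E →ₗ[ℝ] Lob E E :=
  LinearMap.mk₂ ℝ (fun T S => ⟨S.1 ∘ₗ T.1, S.2.1.comp T.2⟩)
    (fun _ _ S => Subtype.ext (LinearMap.comp_add _ _ S.1))
    (fun _ _ S => Subtype.ext (LinearMap.comp_smul S.1 _ _))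
    (fun T _ _ => Subtype.ext (LinearMap.add_comp T.1 _ _))
    (fun _ _ _ => Subtype.ext (LinearMap.smul_comp _ _ _))

variable (E) in
/-- `T ↦ (S ↦ T S)` for `T, S ∈ 𝓛_ob(E)`. -/
def compLeft : Lob E E →ₗ[ℝ] Lob E E →ₗ[ℝ] Lob E E :=
  LinearMap.mk₂ ℝ (fun T S => ⟨T.1 ∘ₗ S.1, T.2.comp S.2⟩)
    (fun _ _ S => Subtype.ext (LinearMap.add_comp S.1 _ _))
    (fun _ _ _ => Subtype.ext (LinearMap.smul_comp _ _ _))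
    (fun T _ _ => Subtype.ext (LinearMap.comp_add _ _ T.1))
    (fun _ T _ => Subtype.ext (LinearMap.comp_smul T.1 _ _))

theorem compRight_nonneg {T : Lob E E} (hT : 0 ≤ T) (S : Loc E E) (hS : 0 ≤ S) :
    0 ≤ compRight E T S := fun x hx => hS _ (hT x hx)

theorem compLeft_nonneg {T : Lob E E} (hT : 0 ≤ T) (S : Lob E E) (hS : 0 ≤ S) :
    0 ≤ compLeft E T S := fun x hx => hT _ (hS x hx)

theorem compRight_mem (T : Lob E E) : compRight E T ∈ orderCont (Loc E E) (Lob E E) := by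
  have key : ∀ T : Lob E E, 0 ≤ T → compRight E T ∈ orderCont (Loc E E) (Lob E E) :=
    fun T hT => ⟨isOrderBounded_of_pos (compRight_nonneg hT),
      -- If `y b` decreases to `0` in `𝓛_oc`, then so does `y b (T x)` in `E`, whatever the
      -- continuity of `T`.
      isOrderContinuous_of_pos (compRight_nonneg hT) fun _ _ _ _ y hy hy0 _ hl x hx =>
        Loc.nonpos_of_forall_le_apply hy hy0 (hT x hx) fun b => hl b x hx⟩
  rw [← posPart_sub_negPart T, map_sub]
  exact sub_mem (key _ (posPart_nonneg T)) (key _ (negPart_nonneg T))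

theorem compLeft_isOrderBounded (T : Lob E E) : compLeft E T ∈ orderBounded (Lob E E) (Lob E E) := by
  rw [← posPart_sub_negPart T, map_sub]
  exact sub_mem (isOrderBounded_of_pos (compLeft_nonneg (posPart_nonneg T)))
    (isOrderBounded_of_pos (compLeft_nonneg (negPart_nonneg T)))

theorem compLeft_mem {T : Lob E E} (hT : IsOrderContinuous T.1) :
    compLeft E T ∈ orderCont (Lob E E) (Lob E E) := by
  have key : ∀ T : Lob E E, 0 ≤ T → IsOrderContinuous T.1 →
      compLeft E T ∈ orderCont (Lob E E) (Lob E E) :=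
    fun T hT hTc => ⟨isOrderBounded_of_pos (compLeft_nonneg hT),
      isOrderContinuous_of_pos (compLeft_nonneg hT) fun _ _ _ _ y hy hy0 _ hl x hx =>
        -- Here `T` acts after the net, so `y b x ↓ 0` must be carried through `T`: this is where
        -- its order continuity is used.
        hTc.nonpos_of_forall_le (y := fun b => (y b).1 x) (fun a b hab => hy hab x hx)
          ⟨by rintro _ ⟨b, rfl⟩; exact hy0.1 ⟨b, rfl⟩ x hx, fun z hz =>
            Lob.nonpos_of_forall_le_apply hy hy0 hx fun b => hz ⟨b, rfl⟩⟩ fun b => hl b x hx⟩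
  have hneg : IsOrderContinuous (-T).1 :=
    ((orderCont E E).neg_mem (show T.1 ∈ orderCont E E from ⟨T.2, hT⟩)).2
  rw [← posPart_sub_negPart T, map_sub]
  exact sub_mem (key _ (posPart_nonneg T) (Lob.sup_zero_mem hT))
    (key _ (negPart_nonneg T) (Lob.sup_zero_mem hneg))

variable (E) in
/-- `T ↦ ρ_T`. -/
def rightMul : Lob E E →ₗ[ℝ] Loc (Loc E E) (Lob E E) :=
  (compRight E).codRestrict (orderCont (Loc E E) (Lob E E)) compRight_mem

variable (E) in
/-- `T ↦ λ_T`. -/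
def leftMul : Lob E E →ₗ[ℝ] Lob (Lob E E) (Lob E E) :=
  (compLeft E).codRestrict (orderBounded (Lob E E) (Lob E E)) compLeft_isOrderBounded

theorem rightMul_isLatticeHom : IsLatticeHom (rightMul E) := by
  refine isLatticeHom_of_map_sup_zero fun T => le_antisymm (fun S hS x hx => ?_) (sup_le ?_ ?_)
  · have hU0 : 0 ≤ (rightMul E T ⊔ 0).toLob := (le_sup_right : 0 ≤ rightMul E T ⊔ 0)
    refine Loc.comp_posPart_apply_le hS hx fun R hR0 hR1 z hz => ?_
    -- With `U = ρ_T ⊔ 0` this is `R T ≤ U R ≤ U S`, the second step by positivity of `U`.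
    exact ((le_sup_left : rightMul E T ≤ rightMul E T ⊔ 0) R hR0 z hz).trans (Lob.mono hU0 hR1 z hz)
  · exact fun S hS x hx => map_le_map_of_pos hS ((le_sup_left : T ≤ T ⊔ 0) x hx)
  · exact compRight_nonneg le_sup_right

theorem leftMul_isLatticeHom : IsLatticeHom (leftMul E) := by
  refine isLatticeHom_of_map_sup_zero fun T => le_antisymm (fun S hS x hx => ?_) (sup_le ?_ ?_)
  · have hU0 : 0 ≤ leftMul E T ⊔ 0 := le_sup_right
    refine Lob.comp_posPart_apply_le hS hx fun R hR0 hR1 z hz => ?_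
    exact ((le_sup_left : leftMul E T ≤ leftMul E T ⊔ 0) R hR0 z hz).trans (Lob.mono hU0 hR1 z hz)
  · exact fun S hS x hx => (le_sup_left : T ≤ T ⊔ 0) _ (hS x hx)
  · exact compLeft_nonneg le_sup_right

theorem rightMul_isOrderContinuous : IsOrderContinuous (rightMul E) :=
  isOrderContinuous_of_pos (fun _ hT => compRight_nonneg hT)
    fun _ _ _ _ y hy hy0 _ hl S hS x hx =>
      S.2.2.nonpos_of_forall_le (y := fun b => (y b).1 x) (fun a b hab => hy hab x hx)
        ⟨by rintro _ ⟨b, rfl⟩; exact hy0.1 ⟨b, rfl⟩ x hx, fun z hz =>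
          Lob.nonpos_of_forall_le_apply hy hy0 hx fun b => hz ⟨b, rfl⟩⟩ fun b => hl b S hS x hx

theorem leftMul_isOrderContinuous : IsOrderContinuous (leftMul E) :=
  isOrderContinuous_of_pos (fun _ hT => compLeft_nonneg hT)
    fun _ _ _ _ _ hy hy0 _ hl S hS x hx =>
      Lob.nonpos_of_forall_le_apply hy hy0 (hS x hx) fun b => hl b S hS x hx

end Composition
end VLat
end

/-- That `ρ_T` is order continuous and `λ_T` order bounded is carried by the codomains of `ρ` and
`L`; the composition identities determine both maps. -/
theorem mainTheorem3 {E : Type u} [AddCommGroup E] [ConditionallyCompleteLattice E]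
    [IsOrderedAddMonoid E] [Module ℝ E] [IsOrderedModule ℝ E] :
    (∃ ρ : VLat.Lob E E →ₗ[ℝ] VLat.Loc (VLat.Loc E E) (VLat.Lob E E),
      (∀ (T : VLat.Lob E E) (S : VLat.Loc E E), ((ρ T).1 S).1 = S.1 ∘ₗ T.1) ∧
      VLat.IsLatticeHom ρ ∧ VLat.IsOrderContinuous ρ) ∧
    (∃ L : VLat.Lob E E →ₗ[ℝ] VLat.Lob (VLat.Lob E E) (VLat.Lob E E),
      (∀ T S : VLat.Lob E E, ((L T).1 S).1 = T.1 ∘ₗ S.1) ∧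
      VLat.IsLatticeHom L ∧ VLat.IsOrderContinuous L ∧
      ∀ T : VLat.Lob E E, T.1 ∈ VLat.orderCont E E →
        (L T).1 ∈ VLat.orderCont (VLat.Lob E E) (VLat.Lob E E)) :=
  ⟨⟨VLat.rightMul E, fun _ _ => rfl, VLat.rightMul_isLatticeHom, VLat.rightMul_isOrderContinuous⟩,
    ⟨VLat.leftMul E, fun _ _ => rfl, VLat.leftMul_isLatticeHom, VLat.leftMul_isOrderContinuous,
      fun _ hT => VLat.compLeft_mem hT.2⟩⟩
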